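/- **Lemma.** Let $X$ be a $\mathrm{CAT}(0)$ cube complex, that is, a simply connected (in particular nonempty and connected) cube complex all of whose vertex links are flag complexes. All cubes are finite-dimensional, but $X$ may be infinite-dimensional (even contain infinite ascending sequences of cubes) and need not be locally finite. Let $d$ be the combinatorial metric on the set $X^0$ of $0$-cubes, i.e. the graph metric of the $1$-skeleton. For a (combinatorial) automorphism $g$ of $X$ put $$\|g\|=\min_{x\in X^0} d(x,gx),\qquad \operatorname{Min} g=\{x\in X^0 : d(x,gx)=\|g\|\}.$$ Call $g$ *loxodromic* if it acts as a nontrivial translation on some bi-infinite combinatorial geodesic, i.e. if there are a map $\gamma:\mathbb Z\to X^0$ with $d(\gamma(i),\gamma(j))=|i-j|$ for all $i,j\in\mathbb Z$ and an integer $n\neq 0$ with $g\gamma(i)=\gamma(i+n)$ for all $i\in\mathbb Z$. If $g$ and $h$ are commuting loxodromic automorphisms of $X$, then there is an integer $m>0$ such that $\operatorname{Min} g\cap\operatorname{Min} h^m\neq\emptyset$. -/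

import Mathlib

/-- The face of the combinatorial cube `{0,1}ⁿ` obtained by freezing the coordinates in `s` to
their values in `a`. -/
def cubeFace {n : ℕ} (s : Set (Fin n)) (a : Fin n → Bool) : Set (Fin n → Bool) :=
  {x | ∀ i ∈ s, x i = a i}

/-- A cube complex with set of `0`-cubes `V`, recorded combinatorially: each cube is recorded by its
set of vertices, cubes are embedded, and two cubes that meet do so in a common face.  All cubes are
finite-dimensional; there is no bound on the dimension and no local finiteness. -/
structure CubeComplex (V : Type*) where
  /-- The vertex sets of the cubes of all dimensions. -/
  cubes : Set (Set V)
  /-- Every element of `V` is a `0`-cube. -/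
  singleton_mem : ∀ v : V, {v} ∈ cubes
  /-- Every cube is a copy of some `{0,1}ⁿ`, and the cubes contained in it are exactly the images
  of the faces of `{0,1}ⁿ`. -/
  exists_param : ∀ C ∈ cubes, ∃ (n : ℕ) (f : (Fin n → Bool) → V),
    Function.Injective f ∧ Set.range f = C ∧
      ∀ D ⊆ C, D ∈ cubes ↔ ∃ (s : Set (Fin n)) (a : Fin n → Bool), D = f '' cubeFace s a
  /-- Two cubes that meet do so in a cube, which is then a face of both. -/
  inter_mem : ∀ C ∈ cubes, ∀ D ∈ cubes, (C ∩ D).Nonempty → C ∩ D ∈ cubes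

namespace CubeComplex

variable {V : Type*}

/-- The `1`-skeleton. -/
def graph (X : CubeComplex V) : SimpleGraph V where
  Adj u v := u ≠ v ∧ {u, v} ∈ X.cubes
  symm := ⟨fun u v h => ⟨h.1.symm, by rw [Set.pair_comm]; exact h.2⟩⟩
  loopless := ⟨fun _ h => h.1 rfl⟩

/-- The simplices of the link of `v`.  The vertices of the link are the edges at `v` (recorded by
their other endpoint), and each cube of positive dimension containing `v` contributes the simplex
formed by its edges at `v`.  (As cubes meet in common faces, distinct cubes at `v` give distinct
simplices, so that the link is a simplicial complex.) -/
def linkSimplices (X : CubeComplex V) (v : V) : Set (Set V) :=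
  {A | A.Nonempty ∧ ∃ C ∈ X.cubes, v ∈ C ∧ A = {w | w ∈ C ∧ X.graph.Adj v w}}

/-- The link of `v` is a flag complex: finitely many vertices that are pairwise joined by an edge
of the link span a simplex. -/
def LinkIsFlag (X : CubeComplex V) (v : V) : Prop :=
  ∀ A : Finset V, A.Nonempty → (∀ a ∈ A, X.graph.Adj v a) →
    (∀ a ∈ A, ∀ b ∈ A, a ≠ b → ({a, b} : Set V) ∈ X.linkSimplices v) →
      (A : Set V) ∈ X.linkSimplices v

/-- Homotopy of edge paths relative to their endpoints in the `2`-skeleton: the equivalence relation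
generated by deleting a backtrack and by pushing a path across a square. -/
inductive PathHomotopic (X : CubeComplex V) :
    ∀ {u v : V}, X.graph.Walk u v → X.graph.Walk u v → Prop
  | refl {u v : V} (p : X.graph.Walk u v) : PathHomotopic X p p
  | symm {u v : V} {p q : X.graph.Walk u v} : PathHomotopic X p q → PathHomotopic X q p
  | trans {u v : V} {p q r : X.graph.Walk u v} :
      PathHomotopic X p q → PathHomotopic X q r → PathHomotopic X p r
  | backtrack {u a b v : V} (p : X.graph.Walk u a) (hab : X.graph.Adj a b) (q : X.graph.Walk a v) :
      PathHomotopic X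
        (p.append (SimpleGraph.Walk.cons hab (SimpleGraph.Walk.cons hab.symm q))) (p.append q)
  | square {u a b c d v : V} (p : X.graph.Walk u a)
      (hab : X.graph.Adj a b) (hbc : X.graph.Adj b c)
      (had : X.graph.Adj a d) (hdc : X.graph.Adj d c)
      (hsq : ({a, b, c, d} : Set V) ∈ X.cubes) (q : X.graph.Walk c v) :
      PathHomotopic X
        (p.append (SimpleGraph.Walk.cons hab (SimpleGraph.Walk.cons hbc q)))
        (p.append (SimpleGraph.Walk.cons had (SimpleGraph.Walk.cons hdc q)))

/-- Simple connectedness: the complex is nonempty and connected, and every closed edge path is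
null-homotopic. -/
def SimplyConnected (X : CubeComplex V) : Prop :=
  X.graph.Connected ∧
    ∀ (v : V) (p : X.graph.Walk v v), X.PathHomotopic p SimpleGraph.Walk.nil

/-- A cube complex is `CAT(0)` if it is simply connected and the links of its vertices are flag
complexes. -/
def IsCAT0 (X : CubeComplex V) : Prop :=
  X.SimplyConnected ∧ ∀ v : V, X.LinkIsFlag v

/-- The group of (combinatorial) automorphisms: permutations of the vertices that, together with
their inverse, map cubes to cubes. -/
def Aut (X : CubeComplex V) : Subgroup (Equiv.Perm V) where
  carrier := {g | ∀ C : Set V, g '' C ∈ X.cubes ↔ C ∈ X.cubes}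
  one_mem' := fun C => by simp
  mul_mem' := fun {g h} hg hh C => by
    rw [Equiv.Perm.coe_mul, Set.image_comp, hg, hh]
  inv_mem' := fun {g} hg C => by
    rw [← hg, ← Set.image_comp]
    simp

/-- The combinatorial metric on the `0`-cubes. -/
noncomputable def dist (X : CubeComplex V) (x y : V) : ℕ :=
  X.graph.dist x y

/-- The map `γ : ℤ → V` is a bi-infinite (combinatorial) geodesic. -/
def IsGeodesicLine (X : CubeComplex V) (γ : ℤ → V) : Prop :=
  ∀ i j : ℤ, X.dist (γ i) (γ j) = (i - j).natAbs

/-- The automorphism `g` is loxodromic: it acts as a nontrivial translation on some bi-infinite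
geodesic. -/
def IsLoxodromic (X : CubeComplex V) (g : X.Aut) : Prop :=
  ∃ γ : ℤ → V, X.IsGeodesicLine γ ∧
    ∃ n : ℤ, n ≠ 0 ∧ ∀ i : ℤ, (g : Equiv.Perm V) (γ i) = γ (i + n)

/-- The translation length `‖g‖`, the minimum of `d(x, g x)` over all `0`-cubes `x`. -/
noncomputable def translationLength (X : CubeComplex V) (g : X.Aut) : ℕ :=
  ⨅ x : V, X.dist x ((g : Equiv.Perm V) x)

/-- The combinatorial minset `Min g`. -/
def minset (X : CubeComplex V) (g : X.Aut) : Set V :=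
  {x | X.dist x ((g : Equiv.Perm V) x) = X.translationLength g}

end CubeComplex

/-! ### Squares and corners of cubes. -/

namespace CubeComplex

variable {V : Type*}

/-! Call the g-orbit of y monotone if, for each halfspace H, membership of g^k y in H is monotone or
antitone in k. Then d(y, g^k y) = k d(y, g y), and this linear growth puts y in Min g. Points of an
axis have monotone orbits, because halfspaces and their complements are convex. Take x on an axis of
g, q on an axis of h, and f = h^m. The median y of x, f x, f² x is the required point.

For g: f commutes with g, so x, f x and f² x all have monotone g-orbits. Two such orbits never cross
a halfspace in opposite directions (`monotone_of_not_antitone`), so the majority of the three is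
again monotone.

For f: only finitely many halfspaces separate x from q, so m can be chosen such that a nonzero power
of f carries one of them to another, or to itself, only if f fixes it (`exists_pow_smul_eq`). If f
moves H, the sequences f^j x ∈ H and f^j q ∈ H then differ for at most one j. The second is
monotone, and a majority over three consecutive terms repairs a single error; hence the f-orbit of y
is monotone (`orbitMonotone_median_of_agree`).

The geometry comes from edge paths modulo pushing across squares. Flag links give `exchange`; simple
connectedness makes reduced paths with given endpoints unique up to square moves
(`IsEdgePath.equiv_of_reduced`). This yields `dist_adj` and `quadrangle`, and from these halfspaces
and medians. -/

theorem cubeFace_compl_singleton {n : ℕ} (i : Fin n) (a : Fin n → Bool) :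
    cubeFace {i}ᶜ a = {a, Function.update a i (!a i)} := by
  ext x
  simp only [cubeFace, Set.mem_compl_iff, Set.mem_singleton_iff, Set.mem_ofPred_eq,
    Set.mem_insert_iff]
  constructor
  · intro h
    by_cases hx : x i = a i
    · left; funext j; by_cases hj : j = i
      · rw [hj, hx]
      · exact h j hj
    · right; funext j; by_cases hj : j = i
      · subst hj; simp [Bool.eq_not_of_ne hx]
      · simp [hj, h j hj]
  · rintro (rfl | rfl) j hj <;> simp [hj]

theorem cubeFace_compl_pair {n : ℕ} (i j : Fin n) (a : Fin n → Bool) :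
    cubeFace {i, j}ᶜ a = {a, Function.update a i (!a i),
      Function.update (Function.update a i (!a i)) j (!a j), Function.update a j (!a j)} := by
  ext x
  simp only [cubeFace, Set.mem_compl_iff, Set.mem_singleton_iff, Set.mem_ofPred_eq,
    Set.mem_insert_iff, not_or]
  constructor
  · intro h
    by_cases hx : x i = a i <;> by_cases hy : x j = a j
    · left; funext k; grind
    · right; right; right; funext k
      have := Bool.eq_not_of_ne hy
      grind
    · right; left; funext k
      have := Bool.eq_not_of_ne hx
      grind
    · right; right; left; funext k
      have := Bool.eq_not_of_ne hy
      have := Bool.eq_not_of_ne hx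
      grind
  · rintro (rfl | rfl | rfl | rfl) k ⟨hk, hk'⟩ <;> simp [hk, hk']

/-- `a, b, c, d` are the consecutive corners of a square. -/
structure IsSq (X : CubeComplex V) (a b c d : V) : Prop where
  ab : X.graph.Adj a b
  bc : X.graph.Adj b c
  ad : X.graph.Adj a d
  dc : X.graph.Adj d c
  mem : ({a, b, c, d} : Set V) ∈ X.cubes
  bd : b ≠ d
  ac : a ≠ c

namespace IsSq

variable {X : CubeComplex V} {a b c d e : V}

theorem swap (h : X.IsSq a b c d) : X.IsSq a d c b :=
  ⟨h.ad, h.dc, h.ab, h.bc, by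
    have : ({a, d, c, b} : Set V) = {a, b, c, d} := by ext x; simp; tauto
    rw [this]; exact h.mem, h.bd.symm, h.ac⟩

theorem rotate (h : X.IsSq a b c d) : X.IsSq b c d a :=
  ⟨h.bc, h.dc.symm, h.ab.symm, h.ad, by
    have : ({b, c, d, a} : Set V) = {a, b, c, d} := by ext x; simp; tauto
    rw [this]; exact h.mem, h.ac.symm, h.bd⟩

end IsSq

/-- A parametrization of a cube by `{0,1}ⁿ`. -/
structure IsParam (X : CubeComplex V) {n : ℕ} (C : Set V) (f : (Fin n → Bool) → V) : Prop where
  inj : Function.Injective f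
  range : Set.range f = C
  face : ∀ D ⊆ C, D ∈ X.cubes ↔ ∃ (s : Set (Fin n)) (a : Fin n → Bool), D = f '' cubeFace s a

namespace IsParam

variable {X : CubeComplex V} {n : ℕ} {C : Set V} {f : (Fin n → Bool) → V}

theorem face_mem (hf : X.IsParam C f) (s : Set (Fin n)) (a : Fin n → Bool) :
    f '' cubeFace s a ∈ X.cubes :=
  (hf.face _ (by rw [← hf.range]; exact Set.image_subset_range _ _)).2 ⟨s, a, rfl⟩

theorem update_ne (a : Fin n → Bool) (i : Fin n) : a ≠ Function.update a i (!a i) := by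
  intro h
  have := congrFun h i
  simp at this

theorem adj (hf : X.IsParam C f) (a : Fin n → Bool) (i : Fin n) :
    X.graph.Adj (f a) (f (Function.update a i (!a i))) := by
  refine ⟨hf.inj.ne (update_ne a i), ?_⟩
  have := hf.face_mem {i}ᶜ a
  rwa [cubeFace_compl_singleton, Set.image_pair] at this

theorem exists_update (hf : X.IsParam C f) {a b : Fin n → Bool} (h : X.graph.Adj (f a) (f b)) :
    ∃ i, b = Function.update a i (!a i) := by
  obtain ⟨hne, hmem⟩ := h
  have hab : a ≠ b := fun h => hne (by rw [h])
  have hsub : ({f a, f b} : Set V) ⊆ C := by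
    rw [← hf.range]
    rintro x (rfl | rfl) <;> exact ⟨_, rfl⟩
  obtain ⟨s, a', hs⟩ := (hf.face _ hsub).1 hmem
  rw [← Set.image_pair] at hs
  have hs' := hf.inj.image_injective hs
  obtain ⟨i, hi⟩ := Function.ne_iff.1 hab
  have ha : a ∈ cubeFace s a' := by rw [← hs']; simp
  have hb : b ∈ cubeFace s a' := by rw [← hs']; simp
  have his : i ∉ s := fun his => hi ((ha i his).trans (hb i his).symm)
  -- The face contains `a` and `b`, which differ at `i`, so `i` is free in it; the flip of `a` at
  -- `i` is then one of its only two vertices.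
  have hmem : Function.update a i (!a i) ∈ cubeFace s a' := by
    intro j hj
    have : j ≠ i := fun h => his (h ▸ hj)
    simpa [this] using ha j hj
  rw [← hs'] at hmem
  rcases hmem with h | h
  · exact absurd h.symm (update_ne a i)
  · exact ⟨i, h.symm⟩

theorem isSq (hf : X.IsParam C f) (a : Fin n → Bool) {i j : Fin n} (hij : i ≠ j) :
    X.IsSq (f a) (f (Function.update a i (!a i)))
      (f (Function.update (Function.update a i (!a i)) j (!a j)))
      (f (Function.update a j (!a j))) := by
  have h1 := hf.adj (Function.update a i (!a i)) j
  have h2 := hf.adj (Function.update a j (!a j)) i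
  rw [Function.update_of_ne hij.symm] at h1
  rw [Function.update_of_ne hij, Function.update_comm hij.symm] at h2
  refine ⟨hf.adj a i, h1, hf.adj a j, h2, ?_, ?_, ?_⟩
  · have := hf.face_mem {i, j}ᶜ a
    rwa [cubeFace_compl_pair, Set.image_insert_eq, Set.image_insert_eq, Set.image_pair] at this
  · intro h
    have := congrFun (hf.inj h) i
    simp [hij] at this
  · intro h
    have := congrFun (hf.inj h) j
    simp at this

end IsParam

variable {X : CubeComplex V}

theorem exists_isParam {C : Set V} (hC : C ∈ X.cubes) :
    ∃ (n : ℕ) (f : (Fin n → Bool) → V), X.IsParam C f := by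
  obtain ⟨n, f, h1, h2, h3⟩ := X.exists_param C hC
  exact ⟨n, f, h1, h2, h3⟩

/-- Two edges of a cube that start at the same vertex span a square of the cube. -/
theorem exists_isSq_of_mem {C : Set V} (hC : C ∈ X.cubes) {a b c : V} (hb : b ∈ C) (ha : a ∈ C)
    (hc : c ∈ C) (hab : X.graph.Adj b a) (hbc : X.graph.Adj b c) (hac : a ≠ c) :
    ∃ e ∈ C, X.IsSq b a e c ∧ ¬ X.graph.Adj b e := by
  obtain ⟨n, f, hf⟩ := exists_isParam hC
  rw [← hf.range] at ha hb hc
  obtain ⟨β, rfl⟩ := hb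
  obtain ⟨α, rfl⟩ := ha
  obtain ⟨γ, rfl⟩ := hc
  obtain ⟨i, rfl⟩ := hf.exists_update hab
  obtain ⟨j, rfl⟩ := hf.exists_update hbc
  have hij : i ≠ j := fun h => hac (by rw [h])
  refine ⟨_, by rw [← hf.range]; exact ⟨_, rfl⟩, hf.isSq β hij, fun h => ?_⟩
  obtain ⟨k, hk⟩ := hf.exists_update h
  have h1 := congrFun hk i
  have h2 := congrFun hk j
  by_cases hki : k = i
  · subst hki
    simp [hij.symm] at h2
  · simp [hij, Ne.symm hki] at h1

/-- The two squares meet in a cube containing both edges at `b`, and these span a square inside the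
intersection; its fourth corner lies in both squares. -/
theorem IsSq.eq_of_mem {a b c d e : V} (h : X.IsSq b a d c) (h' : X.IsSq b a e c) : e = d := by
  have hE := X.inter_mem _ h.mem _ h'.mem ⟨b, by simp, by simp⟩
  obtain ⟨t, ⟨ht1, ht2⟩, hs, hn⟩ := exists_isSq_of_mem hE (a := a) (b := b) (c := c)
    (by simp) (by simp) (by simp) h.ab h.ad h.bd
  have hb : t ≠ b := hs.ac.symm
  have ha : t ≠ a := hs.bc.ne.symm
  have hc : t ≠ c := hs.dc.ne.symm
  simp only [Set.mem_insert_iff, Set.mem_singleton_iff, hb, ha, hc, false_or, or_false] at ht1 ht2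
  rw [← ht1, ← ht2]

theorem IsSq.of_adj {a b c d : V} (hab : X.graph.Adj a b) (hbc : X.graph.Adj b c)
    (had : X.graph.Adj a d) (hdc : X.graph.Adj d c) (h : ({a, b, c, d} : Set V) ∈ X.cubes)
    (hbd : b ≠ d) : X.IsSq a b c d := by
  obtain ⟨t, ht, hs, -⟩ := exists_isSq_of_mem h (a := b) (b := a) (c := d)
    (by simp) (by simp) (by simp) hab had hbd
  have h1 : t ≠ b := hs.bc.ne.symm
  have h2 : t ≠ d := hs.dc.ne.symm
  have h3 : t ≠ a := hs.ac.symm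
  simp only [Set.mem_insert_iff, Set.mem_singleton_iff, h1, h2, h3, false_or, or_false] at ht
  subst ht
  exact hs

theorem IsSq.not_adj {a b c d : V} (h : X.IsSq a b c d) : ¬ X.graph.Adj a c := by
  obtain ⟨t, -, hs, hn⟩ := exists_isSq_of_mem h.mem (a := b) (b := a) (c := d)
    (by simp) (by simp) (by simp) h.ab h.ad h.bd
  rw [h.eq_of_mem hs] at hn
  exact hn

theorem IsSq.pair_mem_linkSimplices {a b c d : V} (h : X.IsSq a b c d) :
    ({b, d} : Set V) ∈ X.linkSimplices a := by
  refine ⟨⟨b, by simp⟩, _, h.mem, by simp, ?_⟩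
  ext w
  simp only [Set.mem_insert_iff, Set.mem_singleton_iff, Set.mem_ofPred_eq]
  constructor
  · rintro (rfl | rfl)
    · exact ⟨by simp, h.ab⟩
    · exact ⟨by simp, h.ad⟩
  · rintro ⟨rfl | rfl | rfl | rfl, hw⟩
    · exact absurd rfl hw.ne
    · simp
    · exact absurd hw h.not_adj
    · simp

/-- Three squares at `u` that pairwise share edges span a `3`-cube. -/
theorem exists_cube_corner (hX : X.IsCAT0) {u x y z p q r : V} (hxy : X.IsSq u x p y)
    (hyz : X.IsSq u y q z) (hxz : X.IsSq u x r z) :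
    ∃ w, X.IsSq x p w r ∧ X.IsSq y p w q ∧ X.IsSq z q w r := by
  classical
  have hflag := hX.2 u {x, y, z} ⟨x, by simp⟩ (by
    intro a ha
    simp only [Finset.mem_insert, Finset.mem_singleton] at ha
    rcases ha with rfl | rfl | rfl
    exacts [hxy.ab, hxy.ad, hxz.ad]) (by
    intro a ha b hb hab
    simp only [Finset.mem_insert, Finset.mem_singleton] at ha hb
    rcases ha with rfl | rfl | rfl <;> rcases hb with rfl | rfl | rfl <;>
    first
      | exact absurd rfl hab
      | exact hxy.pair_mem_linkSimplices
      | exact hxz.pair_mem_linkSimplices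
      | exact hyz.pair_mem_linkSimplices
      | exact hxy.swap.pair_mem_linkSimplices
      | exact hxz.swap.pair_mem_linkSimplices
      | exact hyz.swap.pair_mem_linkSimplices)
  obtain ⟨-, C, hC, huC, hA⟩ := hflag
  have hx : x ∈ C := by
    have : x ∈ ((({x, y, z} : Finset V)) : Set V) := by simp
    rw [hA] at this; exact this.1
  have hy : y ∈ C := by
    have : y ∈ ((({x, y, z} : Finset V)) : Set V) := by simp
    rw [hA] at this; exact this.1
  have hz : z ∈ C := by
    have : z ∈ ((({x, y, z} : Finset V)) : Set V) := by simp
    rw [hA] at this; exact this.1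
  obtain ⟨n, f, hf⟩ := exists_isParam hC
  rw [← hf.range] at hx hy hz huC
  obtain ⟨a, rfl⟩ := huC
  obtain ⟨α, rfl⟩ := hx
  obtain ⟨β, rfl⟩ := hy
  obtain ⟨γ, rfl⟩ := hz
  obtain ⟨i, rfl⟩ := hf.exists_update hxy.ab
  obtain ⟨j, rfl⟩ := hf.exists_update hxy.ad
  obtain ⟨k, rfl⟩ := hf.exists_update hxz.ad
  have hij : i ≠ j := fun h => hxy.bd (by rw [h])
  have hik : i ≠ k := fun h => hxz.bd (by rw [h])
  have hjk : j ≠ k := fun h => hyz.bd (by rw [h])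
  obtain rfl := hxy.eq_of_mem (hf.isSq a hij)
  obtain rfl := hyz.eq_of_mem (hf.isSq a hjk)
  obtain rfl := hxz.eq_of_mem (hf.isSq a hik)
  refine ⟨f (Function.update (Function.update (Function.update a i (!a i)) j (!a j)) k (!a k)),
    ?_, ?_, ?_⟩
  · have := hf.isSq (Function.update a i (!a i)) hjk
    simpa [hij.symm, hik.symm] using this
  · have := hf.isSq (Function.update a j (!a j)) hik
    simpa [hij, hjk.symm, Function.update_comm hij.symm] using this
  · have := hf.isSq (Function.update a k (!a k)) hij.symm
    simp only [ne_eq, hik, not_false_eq_true, Function.update_of_ne, hjk] at this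
    convert this using 2
    · exact Function.update_comm hjk _ _ _
    · funext l; grind
    · exact Function.update_comm hik _ _ _

end CubeComplex

/-! ### Vertex sequences up to square moves, and the exchange property. -/

namespace CubeComplex

variable {V : Type*}

/-- A vertex sequence is changed by pushing it across one square. -/
inductive Step (X : CubeComplex V) : List V → List V → Prop
  | swap {a b c d : V} (l : List V) (h : X.IsSq a b c d) : Step X (a :: b :: c :: l) (a :: d :: c :: l)
  | cons (a : V) {l l' : List V} (h : Step X l l') : Step X (a :: l) (a :: l')

/-- Equivalence of vertex sequences under pushing across squares. -/
def SqEquiv (X : CubeComplex V) : List V → List V → Prop :=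
  Relation.ReflTransGen X.Step

/-- The sequence contains a backtrack. -/
inductive HasBacktrack : List V → Prop
  | here (a b : V) (l : List V) : HasBacktrack (a :: b :: a :: l)
  | cons (a : V) {l : List V} (h : HasBacktrack l) : HasBacktrack (a :: l)

/-- No sequence of square moves creates a backtrack. -/
def Reduced (X : CubeComplex V) (l : List V) : Prop :=
  ∀ l', X.SqEquiv l l' → ¬ HasBacktrack l'

variable {X : CubeComplex V}

theorem Step.symm {l l' : List V} (h : X.Step l l') : X.Step l' l := by
  induction h with
  | swap l h => exact .swap l h.swap
  | cons a _ ih => exact .cons a ih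

theorem Step.length_eq {l l' : List V} (h : X.Step l l') : l.length = l'.length := by
  induction h with
  | swap l h => rfl
  | cons a _ ih => simp [ih]

theorem Step.exists_cons {a : V} {l m : List V} (h : X.Step (a :: l) m) : ∃ l', m = a :: l' := by
  cases h with
  | swap l h => exact ⟨_, rfl⟩
  | cons a h => exact ⟨_, rfl⟩

namespace SqEquiv

variable {l l' l'' m : List V} {a b c d : V}

theorem refl (l : List V) : X.SqEquiv l l := Relation.ReflTransGen.refl

theorem trans (h : X.SqEquiv l l') (h' : X.SqEquiv l' l'') : X.SqEquiv l l'' :=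
  Relation.ReflTransGen.trans h h'

theorem symm (h : X.SqEquiv l l') : X.SqEquiv l' l := by
  induction h with
  | refl => exact refl _
  | tail _ h ih => exact (Relation.ReflTransGen.single h.symm).trans ih

theorem cons (a : V) (h : X.SqEquiv l l') : X.SqEquiv (a :: l) (a :: l') := by
  induction h with
  | refl => exact refl _
  | tail _ h ih => exact ih.tail (.cons a h)

theorem swap (l : List V) (h : X.IsSq a b c d) :
    X.SqEquiv (a :: b :: c :: l) (a :: d :: c :: l) :=
  Relation.ReflTransGen.single (.swap l h)

theorem length_eq (h : X.SqEquiv l l') : l.length = l'.length := by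
  induction h with
  | refl => rfl
  | tail _ h ih => exact ih.trans h.length_eq

theorem exists_cons (h : X.SqEquiv (a :: l) m) : ∃ l', m = a :: l' := by
  induction h with
  | refl => exact ⟨_, rfl⟩
  | tail _ h ih =>
    obtain ⟨l', rfl⟩ := ih
    exact h.exists_cons

theorem head_eq (h : X.SqEquiv (a :: l) (b :: l')) : b = a := by
  obtain ⟨_, h⟩ := h.exists_cons
  simp only [List.cons.injEq] at h
  exact h.1

end SqEquiv

/-- The two sequences `v :: a :: p` and `v :: b :: q` agree up to square moves behind `v`, or they
are the two ways around a square at `v`. -/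
def Exchange (X : CubeComplex V) (v a : V) (p : List V) (b : V) (q : List V) : Prop :=
  (a = b ∧ X.SqEquiv (a :: p) (b :: q)) ∨
    ∃ c r, X.IsSq v a c b ∧ X.SqEquiv (a :: p) (a :: c :: r) ∧ X.SqEquiv (b :: q) (b :: c :: r)

theorem Exchange.trans (hX : X.IsCAT0) {v a b d : V} {p q s : List V}
    (ih : ∀ b' c r d' t, (b' :: c :: r).length = (b :: q).length →
      X.SqEquiv (b' :: c :: r) (b' :: d' :: t) → X.Exchange b' c r d' t)
    (h : X.Exchange v a p b q) (h' : X.Exchange v b q d s) : X.Exchange v a p d s := by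
  rcases h with ⟨rfl, h⟩ | ⟨c, r, hs, h1, h2⟩
  · rcases h' with ⟨rfl, h'⟩ | ⟨c, r, hs, h1, h2⟩
    · exact .inl ⟨rfl, h.trans h'⟩
    · exact .inr ⟨c, r, hs, h.trans h1, h2⟩
  · rcases h' with ⟨rfl, h'⟩ | ⟨c', r', hs', h1', h2'⟩
    · exact .inr ⟨c, r, hs, h1, h'.symm.trans h2⟩
    · have key := ih b c r c' r' h2.length_eq.symm (h2.symm.trans h1')
      rcases key with ⟨rfl, key⟩ | ⟨e, t, hs'', k1, k2⟩
      · obtain rfl := hs.rotate.rotate.rotate.eq_of_mem hs'.rotate.swap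
        exact .inl ⟨rfl, h1.trans ((key.cons _).trans h2'.symm)⟩
      -- The neighbours `v`, `c`, `c'` of `b` pairwise span squares. The 3-cube they span has a
      -- square at `v` through `a` and `d`; its far corner is `w`.
      · obtain ⟨w, w1, w2, w3⟩ := exists_cube_corner hX (u := b) (x := v) (y := c) (z := c')
          (p := a) (q := e) (r := d) hs.rotate.rotate.rotate hs'' hs'.rotate.swap
        refine .inr ⟨w, e :: t, w1, h1.trans ((k1.cons _).trans ?_),
          h2'.trans ((k2.cons _).trans ?_)⟩
        · exact .swap _ w2.swap.rotate.rotate.rotate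
        · exact .swap _ w3.rotate.rotate.rotate

/-- Each single move satisfies `Exchange`, so the point is transitivity, which needs the statement
for shorter sequences. -/
theorem exchange (hX : X.IsCAT0) {v a b : V} {p q : List V}
    (h : X.SqEquiv (v :: a :: p) (v :: b :: q)) : X.Exchange v a p b q := by
  induction hn : p.length using Nat.strong_induction_on generalizing v a b p q with
  | _ n ih =>
    have key : ∀ l, X.SqEquiv (v :: a :: p) l → ∃ b q, l = v :: b :: q ∧ X.Exchange v a p b q := by
      intro l hl
      induction hl with
      | refl => exact ⟨_, _, rfl, .inl ⟨rfl, .refl _⟩⟩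
      | tail hl hstep ih' =>
        obtain ⟨b, q, rfl, hE⟩ := ih'
        have hlen := SqEquiv.length_eq hl
        simp only [List.length_cons] at hlen
        have htrans : ∀ {d s}, X.Exchange v b q d s → X.Exchange v a p d s := fun h' =>
          hE.trans hX (fun b' c r d' t hlen' h'' => ih r.length (by
            simp only [List.length_cons] at hlen'; omega) h'' rfl) h'
        cases hstep with
        | swap l hs => exact ⟨_, _, rfl, htrans (.inr ⟨_, _, hs, .refl _, .refl _⟩)⟩
        | cons _ hs =>
          obtain ⟨q', rfl⟩ := hs.exists_cons
          exact ⟨_, _, rfl, htrans (.inl ⟨rfl, Relation.ReflTransGen.single hs⟩)⟩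
    obtain ⟨b', q', h1, h2⟩ := key _ h
    simp only [List.cons.injEq, true_and] at h1
    obtain ⟨rfl, rfl⟩ := h1
    exact h2

theorem SqEquiv.cons_cancel (hX : X.IsCAT0) {v a : V} {p q : List V}
    (h : X.SqEquiv (v :: a :: p) (v :: a :: q)) : X.SqEquiv (a :: p) (a :: q) := by
  rcases exchange hX h with ⟨-, h⟩ | ⟨c, r, hs, -, -⟩
  · exact h
  · exact absurd rfl hs.bd

theorem Reduced.of_equiv {l l' : List V} (h : X.Reduced l) (h' : X.SqEquiv l l') : X.Reduced l' :=
  fun _ hm => h _ (h'.trans hm)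

theorem Reduced.of_cons {a : V} {l : List V} (h : X.Reduced (a :: l)) : X.Reduced l :=
  fun _ hm hb => h _ (hm.cons a) (hb.cons a)

/-- The analogue of the exchange condition for Coxeter groups: if prepending `w` destroys
reducedness, then `w` itself can be cancelled. -/
theorem Reduced.exists_of_not_cons (hX : X.IsCAT0) {v w : V} {p : List V} (h : X.Reduced (v :: p))
    (h' : ¬ X.Reduced (w :: v :: p)) : ∃ q, X.SqEquiv (v :: p) (v :: w :: q) := by
  induction hn : p.length using Nat.strong_induction_on generalizing v w p with
  | _ n ih =>
    simp only [Reduced, not_forall, not_not] at h'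
    obtain ⟨z, hz, hb⟩ := h'
    obtain ⟨y, rfl⟩ := hz.exists_cons
    cases hb with
    | here _ u z =>
      rcases exchange hX hz with ⟨rfl, h1⟩ | ⟨c, r, hs, h1, h2⟩
      · exact ⟨_, h1⟩
      · rcases exchange hX h2 with ⟨rfl, -⟩ | ⟨e, s, hs', h3, h4⟩
        · exact absurd rfl hs.ac
        -- The two squares share a corner at `u`, so `e` is `v`, and `v :: p` would itself acquire
        -- the backtrack `v, c, v`.
        · obtain rfl := hs'.eq_of_mem hs.rotate.rotate.rotate
          exact absurd (.here _ _ _) (h _ (h1.trans (h4.cons _)))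
    | cons _ hb =>
      have : ∃ y0 y', y = y0 :: y' := by cases hb <;> exact ⟨_, _, rfl⟩
      obtain ⟨y0, y', rfl⟩ := this
      rcases exchange hX hz with ⟨rfl, h1⟩ | ⟨c, r, hs, h1, h2⟩
      · exact absurd hb (h _ h1)
      · have hlen := h1.length_eq
        simp only [List.length_cons] at hlen
        obtain ⟨q, hq⟩ := ih r.length (by omega) (w := y0) (h.of_equiv h1).of_cons
          (fun hr => hr _ h2.symm hb) rfl
        exact ⟨_, h1.trans ((hq.cons _).trans (.swap _ hs.rotate))⟩

/-! ### The action of edges on reduced sequences. -/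

open Classical in
/-- Extend the sequence `l` by the vertex `w` in front, cancelling a backtrack if there is one up to
square moves. -/
noncomputable def act (X : CubeComplex V) (w : V) (l : List V) : List V :=
  if h : ∃ q : List V, ∃ v, X.SqEquiv l (v :: w :: q) then w :: h.choose else w :: l

theorem act_of_equiv (hX : X.IsCAT0) {v w : V} {l q : List V} (h : X.SqEquiv l (v :: w :: q)) :
    X.SqEquiv (X.act w l) (w :: q) := by
  have hex : ∃ q : List V, ∃ v, X.SqEquiv l (v :: w :: q) := ⟨q, v, h⟩
  rw [act, dif_pos hex]
  obtain ⟨v', h'⟩ := hex.choose_spec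
  have := h'.symm.trans h
  obtain rfl := this.head_eq
  exact this.cons_cancel hX

theorem act_of_forall_not {v w : V} {p : List V}
    (h : ∀ q, ¬ X.SqEquiv (v :: p) (v :: w :: q)) : X.act w (v :: p) = w :: v :: p := by
  rw [act, dif_neg]
  rintro ⟨q, v', h'⟩
  obtain rfl := h'.head_eq
  exact h q h'

theorem act_eq_cons (w : V) (l : List V) : ∃ q, X.act w l = w :: q := by
  rw [act]
  split_ifs <;> exact ⟨_, rfl⟩

theorem act_congr (hX : X.IsCAT0) (w : V) {l l' : List V} (h : X.SqEquiv l l') :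
    X.SqEquiv (X.act w l) (X.act w l') := by
  by_cases hex : ∃ q : List V, ∃ v, X.SqEquiv l (v :: w :: q)
  · obtain ⟨q, v, hq⟩ := hex
    exact (act_of_equiv hX hq).trans (act_of_equiv hX (h.symm.trans hq)).symm
  · have hex' : ¬ ∃ q : List V, ∃ v, X.SqEquiv l' (v :: w :: q) := by
      rintro ⟨q, v, hq⟩
      exact hex ⟨q, v, h.trans hq⟩
    rw [act, act, dif_neg hex, dif_neg hex']
    exact h.cons w

theorem Reduced.act (hX : X.IsCAT0) (w : V) {v : V} {p : List V} (h : X.Reduced (v :: p)) :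
    X.Reduced (X.act w (v :: p)) := by
  by_cases hex : ∃ q, X.SqEquiv (v :: p) (v :: w :: q)
  · obtain ⟨q, hq⟩ := hex
    exact (h.of_equiv hq).of_cons.of_equiv (act_of_equiv hX hq).symm
  · rw [act_of_forall_not (by simpa using hex)]
    by_contra hn
    exact hex (h.exists_of_not_cons hX hn)

theorem act_of_reduced {v w : V} {p : List V} (h : X.Reduced (w :: v :: p)) :
    X.act w (v :: p) = w :: v :: p :=
  act_of_forall_not fun _ hq => h _ (hq.cons w) (.here _ _ _)

theorem act_act (hX : X.IsCAT0) (w : V) {v : V} {p : List V} (h : X.Reduced (v :: p)) :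
    X.SqEquiv (X.act v (X.act w (v :: p))) (v :: p) := by
  by_cases hex : ∃ q, X.SqEquiv (v :: p) (v :: w :: q)
  · obtain ⟨q, hq⟩ := hex
    refine (act_congr hX v (act_of_equiv hX hq)).trans ?_
    rw [act_of_reduced (h.of_equiv hq)]
    exact hq.symm
  · rw [act_of_forall_not (by simpa using hex)]
    exact act_of_equiv hX (.refl _)

/-- With `act_act`, this makes the action of a walk depend only on its homotopy class. The cases are
whether `b` and `d` cancel against the sequence; if neither does, `c` cannot cancel afterwards, and
the results differ by one square move. -/
theorem act_act_of_isSq (hX : X.IsCAT0) {a b c d : V} (hs : X.IsSq a b c d) (p : List V) :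
    X.SqEquiv (X.act c (X.act b (a :: p))) (X.act c (X.act d (a :: p))) := by
  have half : ∀ {b d}, X.IsSq a b c d → (∃ q, X.SqEquiv (a :: p) (a :: b :: q)) →
      (∀ q, ¬ X.SqEquiv (a :: p) (a :: d :: q)) →
      X.SqEquiv (X.act c (X.act b (a :: p))) (X.act c (X.act d (a :: p))) := by
    rintro b d hs ⟨q, hq⟩ hd
    refine (act_congr hX c (act_of_equiv hX hq)).trans ?_
    rw [act_of_forall_not fun q' hq' => hd _ (hq.trans ((hq'.cons a).trans (.swap _ hs))),
      act_of_forall_not hd]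
    exact (act_of_equiv hX ((hq.cons d).trans (.swap _ hs.rotate.rotate.rotate))).symm
  by_cases hb : ∃ q, X.SqEquiv (a :: p) (a :: b :: q) <;>
    by_cases hd : ∃ q, X.SqEquiv (a :: p) (a :: d :: q)
  · obtain ⟨q, hq⟩ := hb
    obtain ⟨q', hq'⟩ := hd
    rcases exchange hX (hq.symm.trans hq') with ⟨h, -⟩ | ⟨e, r, hs', h1, h2⟩
    · exact absurd h hs.bd
    · obtain rfl := hs.eq_of_mem hs'
      exact (act_of_equiv hX ((act_of_equiv hX hq).trans h1)).trans
        (act_of_equiv hX ((act_of_equiv hX hq').trans h2)).symm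
  · exact half hs hb (by simpa using hd)
  · exact (half hs.swap hd (by simpa using hb)).symm
  · have hd' := not_exists.1 hd
    have hb' := not_exists.1 hb
    rw [act_of_forall_not hb', act_of_forall_not hd']
    have aux : ∀ {b d}, X.IsSq a b c d → (∀ q, ¬ X.SqEquiv (a :: p) (a :: d :: q)) →
        ∀ q, ¬ X.SqEquiv (b :: a :: p) (b :: c :: q) := by
      intro b d hs hd q hq
      rcases exchange hX hq with ⟨h, -⟩ | ⟨e, r, hs', h1, -⟩
      · exact hs.ac h
      · obtain rfl := hs.rotate.swap.eq_of_mem hs'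
        exact hd _ h1
    rw [act_of_forall_not (aux hs hd'), act_of_forall_not (aux hs.swap hb')]
    exact .swap _ hs.rotate.rotate.swap

end CubeComplex

/-! ### Uniqueness of reduced edge paths, and the combinatorial metric. -/

namespace CubeComplex

variable {V : Type*} {X : CubeComplex V}

/-- Successively extend the vertex sequence `l` by the vertices of a walk. -/
noncomputable def run (X : CubeComplex V) : ∀ {u v : V}, X.graph.Walk u v → List V → List V
  | _, _, .nil, l => l
  | _, _, .cons (v := w) _ p, l => run X p (X.act w l)

theorem run_append {u v w : V} (p : X.graph.Walk u v) (q : X.graph.Walk v w) (l : List V) :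
    X.run (p.append q) l = X.run q (X.run p l) := by
  induction p generalizing l with
  | nil => rfl
  | cons h p ih => exact ih q _

theorem run_congr (hX : X.IsCAT0) {u v : V} (p : X.graph.Walk u v) {l l' : List V}
    (h : X.SqEquiv l l') : X.SqEquiv (X.run p l) (X.run p l') := by
  induction p generalizing l l' with
  | nil => exact h
  | cons _ p ih => exact ih (act_congr hX _ h)

theorem run_spec (hX : X.IsCAT0) {u v : V} (p : X.graph.Walk u v) {l : List V}
    (h : X.Reduced (u :: l)) : ∃ l', X.run p (u :: l) = v :: l' ∧ X.Reduced (v :: l') := by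
  induction p generalizing l with
  | nil => exact ⟨_, rfl, h⟩
  | @cons u w v _ p ih =>
    obtain ⟨q, hq⟩ := X.act_eq_cons w (u :: l)
    have := h.act hX w
    rw [hq] at this
    rw [run, hq]
    exact ih this

theorem run_reverse (hX : X.IsCAT0) {u v : V} (p : X.graph.Walk u v) {l : List V}
    (h : X.Reduced (u :: l)) : X.SqEquiv (X.run p.reverse (X.run p (u :: l))) (u :: l) := by
  induction p generalizing l with
  | nil => exact .refl _
  | @cons u w v _ p ih =>
    rw [SimpleGraph.Walk.reverse_cons, run_append, run, run, run]
    have h' := h.act hX w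
    obtain ⟨q, hq⟩ := X.act_eq_cons w (u :: l)
    rw [hq] at h'
    have := act_act hX w h
    rw [hq] at this ⊢
    exact (act_congr hX u (ih h')).trans this

theorem PathHomotopic.run_equiv (hX : X.IsCAT0) {u v : V} {p q : X.graph.Walk u v}
    (h : X.PathHomotopic p q) {l : List V} (hl : X.Reduced (u :: l)) :
    X.SqEquiv (X.run p (u :: l)) (X.run q (u :: l)) := by
  induction h with
  | refl p => exact .refl _
  | symm _ ih => exact ih.symm
  | trans _ _ ih ih' => exact ih.trans ih'
  | @backtrack a b v p hab q =>
    obtain ⟨l', h1, h2⟩ := run_spec hX p hl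
    simp only [run_append, run, h1]
    exact run_congr hX q (act_act hX b h2)
  | @square a b c d v p hab hbc had hdc hsq q =>
    obtain ⟨l', h1, h2⟩ := run_spec hX p hl
    simp only [run_append, run, h1]
    by_cases hbd : b = d
    · subst hbd
      exact .refl _
    · exact run_congr hX q (act_act_of_isSq hX (.of_adj hab hbc had hdc hsq hbd) l')

/-- Simple connectedness enters here: the loop `p.append q.reverse` acts trivially, and running `q`
undoes `q.reverse`. -/
theorem run_equiv (hX : X.IsCAT0) {u v : V} (p q : X.graph.Walk u v) {l : List V}
    (hl : X.Reduced (u :: l)) : X.SqEquiv (X.run p (u :: l)) (X.run q (u :: l)) := by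
  have h1 := (hX.1.2 u (p.append q.reverse)).run_equiv hX hl
  rw [run_append, run] at h1
  obtain ⟨l', h2, h3⟩ := run_spec hX p hl
  have h4 := run_reverse hX q.reverse (l := l') h3
  rw [SimpleGraph.Walk.reverse_reverse, ← h2] at h4
  exact h4.symm.trans (run_congr hX q h1)

/-- The sequence of vertices of an edge path that ends in `x`. -/
inductive IsEdgePath (X : CubeComplex V) (x : V) : List V → Prop
  | base : IsEdgePath X x [x]
  | cons {v w : V} {l : List V} (h : X.graph.Adj w v) (hl : IsEdgePath X x (v :: l)) :
      IsEdgePath X x (w :: v :: l)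

theorem reduced_singleton (x : V) : X.Reduced [x] := by
  intro l h hb
  have := h.length_eq
  rcases hb with _ | ⟨_, hb⟩
  · simp at this
  · rcases hb with _ | ⟨_, hb⟩ <;> simp at this

namespace IsEdgePath

variable {x v w : V} {l l' : List V}

theorem step (h : X.IsEdgePath x l) (hs : X.Step l l') : X.IsEdgePath x l' := by
  induction hs with
  | swap m hs =>
    rcases h with _ | ⟨_, _ | ⟨_, h⟩⟩
    exact .cons hs.ad (.cons hs.dc h)
  | cons a hs ih =>
    rcases h with _ | ⟨h, hl⟩
    · cases hs
    · obtain ⟨_, rfl⟩ := hs.exists_cons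
      exact .cons h (ih hl)

theorem equiv (h : X.IsEdgePath x l) (hs : X.SqEquiv l l') : X.IsEdgePath x l' := by
  induction hs with
  | refl => exact h
  | tail _ hs ih => exact ih.step hs

theorem dist_le (h : X.IsEdgePath x (v :: l)) : X.dist x v ≤ l.length := by
  suffices H : ∃ p : X.graph.Walk x v, p.length = l.length by
    obtain ⟨p, hp⟩ := H
    rw [← hp]
    exact SimpleGraph.dist_le p
  generalize hm : v :: l = m at h
  induction h generalizing v l with
  | base =>
    obtain ⟨rfl, rfl⟩ := List.cons.inj hm
    exact ⟨.nil, rfl⟩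
  | cons h _ ih =>
    obtain ⟨rfl, rfl⟩ := List.cons.inj hm
    obtain ⟨p, hp⟩ := ih rfl
    exact ⟨p.concat h.symm, by simp [hp]⟩

theorem exists_shorter (h : X.IsEdgePath x (v :: l)) (hb : HasBacktrack (v :: l)) :
    ∃ l', X.IsEdgePath x (v :: l') ∧ l'.length < l.length := by
  generalize hm : v :: l = m at h
  induction h generalizing v l with
  | base =>
    rw [hm] at hb
    cases hb with | cons _ hb => cases hb
  | cons h hl ih =>
    obtain ⟨rfl, rfl⟩ := List.cons.inj hm
    rcases hb with ⟨_, _, m⟩ | ⟨_, hb⟩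
    · rcases hl with _ | ⟨_, hl⟩
      exact ⟨m, hl, by simp⟩
    · obtain ⟨l', h1, h2⟩ := ih hb rfl
      exact ⟨_, .cons h h1, by simpa using h2⟩

theorem exists_of_dist (hX : X.IsCAT0) (x v : V) :
    ∃ l, X.IsEdgePath x (v :: l) ∧ l.length = X.dist x v := by
  have : ∀ {u} (p : X.graph.Walk u x), ∃ l, X.IsEdgePath x (u :: l) ∧ l.length = p.length := by
    intro u p
    induction p with
    | nil => exact ⟨[], .base, rfl⟩
    | cons h p ih =>
      obtain ⟨l, h1, h2⟩ := ih
      exact ⟨_, .cons h h1, by simp [h2]⟩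
  obtain ⟨p, hp⟩ := hX.1.1.exists_walk_length_eq_dist v x
  obtain ⟨l, h1, h2⟩ := this p
  exact ⟨l, h1, by rw [h2, hp, CubeComplex.dist, SimpleGraph.dist_comm]⟩

theorem reduced (h : X.IsEdgePath x (v :: l)) (hl : l.length = X.dist x v) :
    X.Reduced (v :: l) := by
  intro m hm hb
  obtain ⟨l', rfl⟩ := hm.exists_cons
  obtain ⟨l'', h1, h2⟩ := (h.equiv hm).exists_shorter hb
  have h3 := h1.dist_le
  have h4 := hm.length_eq
  simp only [List.length_cons] at h4
  omega

/-- Running along a reduced path never cancels, so it reproduces that path. -/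
theorem exists_run (hX : X.IsCAT0) (h : X.IsEdgePath x (v :: l)) (hr : X.Reduced (v :: l)) :
    ∃ p : X.graph.Walk x v, X.SqEquiv (X.run p [x]) (v :: l) := by
  generalize hm : v :: l = m at h
  induction h generalizing v l with
  | base =>
    obtain ⟨rfl, rfl⟩ := List.cons.inj hm
    exact ⟨.nil, .refl _⟩
  | @cons v' w' l' h _ ih =>
    obtain ⟨rfl, rfl⟩ := List.cons.inj hm
    obtain ⟨p, hp⟩ := ih hr.of_cons rfl
    refine ⟨p.append (.cons h.symm .nil), ?_⟩
    rw [run_append, run, run]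
    have := act_congr hX v hp
    rwa [act_of_reduced hr] at this

/-- Two reduced edge paths with the same endpoints differ by square moves. -/
theorem equiv_of_reduced (hX : X.IsCAT0) (h : X.IsEdgePath x (v :: l)) (hr : X.Reduced (v :: l))
    (h' : X.IsEdgePath x (v :: l')) (hr' : X.Reduced (v :: l')) :
    X.SqEquiv (v :: l) (v :: l') := by
  obtain ⟨p, hp⟩ := h.exists_run hX hr
  obtain ⟨q, hq⟩ := h'.exists_run hX hr'
  exact hp.symm.trans ((run_equiv hX p q (reduced_singleton x)).trans hq)

theorem length_eq_dist (hX : X.IsCAT0) (h : X.IsEdgePath x (v :: l)) (hr : X.Reduced (v :: l)) :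
    l.length = X.dist x v := by
  obtain ⟨m, hm, hm'⟩ := exists_of_dist hX x v
  have := (h.equiv_of_reduced hX hr hm (hm.reduced hm')).length_eq
  simp only [List.length_cons] at this
  omega

end IsEdgePath

theorem dist_comm (x y : V) : X.dist x y = X.dist y x := SimpleGraph.dist_comm

theorem dist_self (x : V) : X.dist x x = 0 := SimpleGraph.dist_self

theorem dist_triangle (hX : X.IsCAT0) (x y z : V) : X.dist x z ≤ X.dist x y + X.dist y z :=
  hX.1.1.dist_triangle

theorem dist_eq_zero (hX : X.IsCAT0) {x y : V} : X.dist x y = 0 ↔ x = y :=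
  hX.1.1.dist_eq_zero_iff

theorem dist_eq_one {x y : V} : X.dist x y = 1 ↔ X.graph.Adj x y :=
  SimpleGraph.dist_eq_one_iff_adj

theorem exists_adj_dist (hX : X.IsCAT0) {x y : V} (h : x ≠ y) :
    ∃ z, X.graph.Adj y z ∧ X.dist x z + 1 = X.dist x y := by
  obtain ⟨l, hl, hl'⟩ := IsEdgePath.exists_of_dist hX x y
  rcases hl with _ | ⟨hadj, hl⟩
  · exact absurd rfl h
  · rename_i v l
    refine ⟨v, hadj, ?_⟩
    have h1 := hl.dist_le
    have h2 := dist_triangle hX x v y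
    rw [dist_eq_one.2 hadj.symm] at h2
    simp only [List.length_cons] at hl'
    omega

/-- Adjacent vertices have different distances to any vertex, differing by one. -/
theorem dist_adj (hX : X.IsCAT0) (x : V) {u v : V} (h : X.graph.Adj u v) :
    X.dist x v = X.dist x u + 1 ∨ X.dist x u = X.dist x v + 1 := by
  obtain ⟨l, hl, hl'⟩ := IsEdgePath.exists_of_dist hX x u
  have hr := hl.reduced hl'
  by_cases hr' : X.Reduced (v :: u :: l)
  · left
    rw [← (IsEdgePath.cons h.symm hl).length_eq_dist hX hr', ← hl', List.length_cons]
  · right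
    obtain ⟨q, hq⟩ := hr.exists_of_not_cons hX hr'
    have h1 := hl.equiv hq
    rcases h1 with _ | ⟨_, h1⟩
    have h2 := h1.length_eq_dist hX (hr.of_equiv hq).of_cons
    have h3 := hq.length_eq
    simp only [List.length_cons] at h3
    omega

/-- The quadrangle condition. -/
theorem quadrangle (hX : X.IsCAT0) {x u v w : V} (hu : X.graph.Adj v u) (hw : X.graph.Adj v w)
    (huw : u ≠ w) (hdu : X.dist x u + 1 = X.dist x v) (hdw : X.dist x w + 1 = X.dist x v) :
    ∃ t, X.IsSq v u t w ∧ X.dist x t + 1 = X.dist x u := by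
  obtain ⟨l, hl, hl'⟩ := IsEdgePath.exists_of_dist hX x u
  obtain ⟨m, hm, hm'⟩ := IsEdgePath.exists_of_dist hX x w
  have h1 := IsEdgePath.cons hu hl
  have h2 := IsEdgePath.cons hw hm
  -- Geodesics from `v` to `x` through `u` and through `w` are both reduced, hence equivalent;
  -- `exchange` then supplies the square.
  have h3 := h1.equiv_of_reduced hX (h1.reduced (by simp [hl', hdu])) h2
    (h2.reduced (by simp [hm', hdw]))
  rcases exchange hX h3 with ⟨h, -⟩ | ⟨t, r, hs, h4, -⟩
  · exact absurd h huw
  · refine ⟨t, hs, ?_⟩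
    have h5 := hl.equiv h4
    rcases h5 with _ | ⟨_, h5⟩
    have h6 := h5.dist_le
    have h7 := h4.length_eq
    simp only [List.length_cons] at h7
    have h8 := dist_triangle hX x t u
    rw [dist_eq_one.2 hs.bc.symm] at h8
    omega

end CubeComplex

/-! ### Halfspaces, separation and medians. -/

namespace CubeComplex

variable {V : Type*} {X : CubeComplex V}

/-- The vertices that are closer to `u` than to `v`. -/
def halfspace (X : CubeComplex V) (u v : V) : Set V :=
  {w | X.dist w u < X.dist w v}

/-- The halfspaces of the complex. -/
def halfspaces (X : CubeComplex V) : Set (Set V) :=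
  {H | ∃ u v, X.graph.Adj u v ∧ H = X.halfspace u v}

theorem mem_halfspace {u v w : V} : w ∈ X.halfspace u v ↔ X.dist w u < X.dist w v := Iff.rfl

theorem self_mem_halfspace {u v : V} (h : X.graph.Adj u v) : u ∈ X.halfspace u v := by
  rw [mem_halfspace, dist_self, dist_eq_one.2 h]
  exact one_pos

theorem halfspace_mem_halfspaces {u v : V} (h : X.graph.Adj u v) :
    X.halfspace u v ∈ X.halfspaces := ⟨u, v, h, rfl⟩

theorem compl_halfspace (hX : X.IsCAT0) {u v : V} (h : X.graph.Adj u v) :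
    (X.halfspace u v)ᶜ = X.halfspace v u := by
  ext w
  have := dist_adj hX w h
  simp only [Set.mem_compl_iff, mem_halfspace]
  omega

theorem compl_mem_halfspaces (hX : X.IsCAT0) {H : Set V} (hH : H ∈ X.halfspaces) :
    Hᶜ ∈ X.halfspaces := by
  obtain ⟨u, v, h, rfl⟩ := hH
  rw [compl_halfspace hX h]
  exact halfspace_mem_halfspaces h.symm

theorem IsSq.halfspace_subset (hX : X.IsCAT0) {a b c d : V} (h : X.IsSq a b c d) :
    X.halfspace a b ⊆ X.halfspace d c := by
  intro w hw
  rw [mem_halfspace] at hw ⊢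
  have h1 := dist_adj hX w h.ab
  have h2 := dist_adj hX w h.bc
  have h3 := dist_adj hX w h.ad
  have h4 := dist_adj hX w h.dc
  by_contra hcon
  -- Otherwise `a` and `c` are equally near to `w`, and `b` and `d` one step further. The quadrangle
  -- at `d` must close up at `b`, which would have to be nearer than `a`.
  obtain ⟨t, ht, ht'⟩ := quadrangle hX (x := w) h.ad.symm h.dc h.ac (by omega) (by omega)
  obtain rfl := ht.eq_of_mem h.rotate.rotate.rotate
  omega

theorem IsSq.halfspace_eq (hX : X.IsCAT0) {a b c d : V} (h : X.IsSq a b c d) :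
    X.halfspace a b = X.halfspace d c :=
  (h.halfspace_subset hX).antisymm (h.rotate.rotate.rotate.swap.halfspace_subset hX)

/-- A halfspace is determined by any edge that crosses its boundary. -/
theorem halfspace_eq_of_mem (hX : X.IsCAT0) {u v x y : V} (huv : X.graph.Adj u v)
    (hxy : X.graph.Adj x y) (hx : x ∈ X.halfspace u v) (hy : y ∉ X.halfspace u v) :
    X.halfspace x y = X.halfspace u v := by
  induction hn : X.dist u x generalizing x y with
  | zero =>
    obtain rfl := (dist_eq_zero hX).1 hn
    have h0 := (dist_adj hX y huv)
    have h1 := dist_adj hX u hxy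
    have h2 := dist_adj hX v hxy
    simp only [mem_halfspace, dist_comm y, dist_self] at *
    rw [dist_eq_one.2 hxy] at *
    have h3 : X.dist v y = 0 := by omega
    rw [(dist_eq_zero hX).1 h3]
  | succ n ih =>
    have hne : u ≠ x := by rintro rfl; simp [dist_self] at hn
    obtain ⟨x', hxx', hx'⟩ := exists_adj_dist hX hne
    have h1 := dist_adj hX u hxy
    have h2 := dist_adj hX v hxy
    have h3 := dist_adj hX x huv
    have h4 := dist_adj hX y huv
    have h5 := dist_adj hX v hxx'
    have h6 := dist_adj hX x' huv
    rw [mem_halfspace] at hx hy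
    simp only [dist_comm y, dist_comm x, dist_comm x'] at *
    have hx'y : x' ≠ y := by rintro rfl; omega
    -- Both `x'` and `y` are one step nearer to `v` than `x`; the square replaces the edge from `x`
    -- to `y` by a parallel one starting nearer to `u`.
    obtain ⟨t, ht, ht'⟩ := quadrangle hX (x := v) hxx' hxy hx'y (by omega) (by omega)
    have h7 := dist_adj hX u ht.dc
    have h8 := dist_adj hX t huv
    simp only [dist_comm t] at *
    rw [ht.swap.halfspace_eq hX]
    exact ih ht.bc (by rw [mem_halfspace, dist_comm x', dist_comm x']; omega)
      (by rw [mem_halfspace, dist_comm t, dist_comm t]; omega) (by omega)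

theorem eq_halfspace (hX : X.IsCAT0) {H : Set V} (hH : H ∈ X.halfspaces) {x y : V}
    (hxy : X.graph.Adj x y) (hx : x ∈ H) (hy : y ∉ H) : H = X.halfspace x y := by
  obtain ⟨u, v, huv, rfl⟩ := hH
  exact (halfspace_eq_of_mem hX huv hxy hx hy).symm

/-- The halfspaces containing `x` but not `y`. -/
def sep (X : CubeComplex V) (x y : V) : Set (Set V) :=
  {H | H ∈ X.halfspaces ∧ x ∈ H ∧ y ∉ H}

/-- The last edge of a geodesic contributes exactly one new separating halfspace. -/
theorem sep_finite_ncard (hX : X.IsCAT0) (x y : V) :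
    (X.sep x y).Finite ∧ (X.sep x y).ncard = X.dist x y := by
  induction hn : X.dist x y generalizing y with
  | zero =>
    obtain rfl := (dist_eq_zero hX).1 hn
    have : X.sep x x = ∅ := by
      ext H; simp [sep]
    simp [this]
  | succ n ih =>
    have hne : x ≠ y := by rintro rfl; simp [dist_self] at hn
    obtain ⟨z, hyz, hz⟩ := exists_adj_dist hX hne
    obtain ⟨h1, h2⟩ := ih z (by omega)
    have hnot : X.halfspace z y ∉ X.sep x z := fun h => h.2.2 (self_mem_halfspace hyz.symm)
    have : X.sep x y = insert (X.halfspace z y) (X.sep x z) := by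
      ext H
      simp only [Set.mem_insert_iff]
      constructor
      · rintro ⟨hH, hx, hy⟩
        by_cases hzH : z ∈ H
        · exact .inl (eq_halfspace hX hH hyz.symm hzH hy)
        · exact .inr ⟨hH, hx, hzH⟩
      · rintro (rfl | ⟨hH, hx, hz'⟩)
        · refine ⟨halfspace_mem_halfspaces hyz.symm, by rw [mem_halfspace]; omega, ?_⟩
          rw [mem_halfspace, dist_self]
          omega
        · refine ⟨hH, hx, fun hy => ?_⟩
          rw [eq_halfspace hX hH hyz hy hz', mem_halfspace] at hx
          omega
    rw [this]
    exact ⟨h1.insert _, by rw [Set.ncard_insert_of_notMem hnot h1, h2]⟩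

/-- Halfspaces are convex. -/
theorem mem_of_between (hX : X.IsCAT0) {x y z : V} (h : X.dist x y + X.dist y z = X.dist x z)
    {H : Set V} (hH : H ∈ X.halfspaces) (hx : x ∈ H) (hz : z ∈ H) : y ∈ H := by
  by_contra hy
  obtain ⟨f1, n1⟩ := sep_finite_ncard hX x y
  obtain ⟨f2, n2⟩ := sep_finite_ncard hX y z
  obtain ⟨f3, n3⟩ := sep_finite_ncard hX x z
  have hmem : H ∈ X.sep x y := ⟨hH, hx, hy⟩
  have hsub : X.sep x z ⊆ (X.sep x y \ {H}) ∪ X.sep y z := by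
    rintro K ⟨hK, hKx, hKz⟩
    by_cases hKy : y ∈ K
    · exact .inr ⟨hK, hKy, hKz⟩
    · exact .inl ⟨⟨hK, hKx, hKy⟩, fun h => hKz (h ▸ hz)⟩
  have h1 := Set.ncard_le_ncard hsub (f1.sdiff.union f2)
  have h2 := Set.ncard_union_le (X.sep x y \ {H}) (X.sep y z)
  have h3 := Set.ncard_sdiff_singleton_add_one hmem f1
  omega

theorem between_of_forall_mem (hX : X.IsCAT0) {x y z : V}
    (h : ∀ H ∈ X.halfspaces, x ∈ H → z ∈ H → y ∈ H) :
    X.dist x y + X.dist y z = X.dist x z := by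
  obtain ⟨f1, n1⟩ := sep_finite_ncard hX x y
  obtain ⟨f2, n2⟩ := sep_finite_ncard hX y z
  obtain ⟨f3, n3⟩ := sep_finite_ncard hX x z
  have hdisj : Disjoint (X.sep x y) (X.sep y z) :=
    Set.disjoint_left.2 fun K h1 h2 => h1.2.2 h2.2.1
  have hsub : X.sep x y ∪ X.sep y z ⊆ X.sep x z := by
    rintro K (⟨hK, h1, h2⟩ | ⟨hK, h1, h2⟩)
    · exact ⟨hK, h1, fun h3 => h2 (h K hK h1 h3)⟩
    · exact ⟨hK, by_contra fun h3 => h _ (compl_mem_halfspaces hX hK) h3 h2 h1, h2⟩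
  have h1 := Set.ncard_le_ncard hsub f3
  rw [Set.ncard_union_eq hdisj f1 f2] at h1
  have := dist_triangle hX x y z
  omega

/-- If `z` is a point of the halfspace `H` nearest to `y`, then the wall of the first edge of any
geodesic from `y` to `z` separates `y` from `H`. -/
theorem subset_halfspace_of_nearest (hX : X.IsCAT0) {H : Set V} (hH : H ∈ X.halfspaces) {z : V}
    (hz : z ∈ H) {y y₁ : V} (hy : y ∉ H) (hmin : ∀ z' ∈ H, X.dist z y ≤ X.dist z' y)
    (hadj : X.graph.Adj y y₁) (hd : X.dist z y₁ + 1 = X.dist z y) : H ⊆ X.halfspace y₁ y := by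
  induction hn : X.dist z y using Nat.strong_induction_on generalizing y y₁ with
  | _ n ih =>
    by_cases hy₁ : y₁ ∈ H
    · exact (eq_halfspace hX hH hadj.symm hy₁ hy).subset
    have hne : z ≠ y₁ := fun h => hy₁ (h ▸ hz)
    obtain ⟨y₂, hadj₂, hd₂⟩ := exists_adj_dist hX hne
    have hsub := ih _ (by omega) hy₁ (fun z' hz' => by
      have := hmin z' hz'
      have := dist_adj hX z' hadj
      omega) hadj₂ hd₂ rfl
    intro w hw
    by_contra hw'
    have h1 := mem_halfspace.1 (hsub hw)
    rw [mem_halfspace] at hw'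
    have h2 := dist_adj hX w hadj
    have h3 := dist_adj hX w hadj₂
    have hne₂ : y ≠ y₂ := by rintro rfl; omega
    -- If `w` were on the side of `y`, both `y` and `y₂` would be nearer to `w` than `y₁`. In the
    -- resulting square the edge from `t` to `y₂` is parallel to that from `y` to `y₁`, and `t` is
    -- nearer to `z`, so induction applies to `t`.
    obtain ⟨t, ht, -⟩ := quadrangle hX (x := w) hadj.symm hadj₂ hne₂ (by omega) (by omega)
    have hzt := hsub hz
    rw [ht.rotate.rotate.rotate.halfspace_eq hX, mem_halfspace] at hzt
    have h4 := dist_adj hX z ht.bc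
    have htH : t ∉ H := by
      intro htH
      have h5 := hmin t htH
      rw [dist_eq_one.2 ht.bc.symm] at h5
      have : X.dist z y₁ = 0 := by omega
      exact hne ((dist_eq_zero hX).1 this)
    have h6 := ih (X.dist z t) (by omega) htH (fun z' hz' => by
      have := hmin z' hz'
      have := dist_adj hX z' ht.bc
      omega) ht.dc.symm (by omega) rfl hw
    rw [← ht.halfspace_eq hX] at h6
    exact hw' h6

/-- `y` lies in the same halfspaces as the majority of `a, b, c`. -/
def IsMedian (X : CubeComplex V) (a b c y : V) : Prop :=
  ∀ H ∈ X.halfspaces, y ∈ H ↔ (a ∈ H ∧ b ∈ H ∨ a ∈ H ∧ c ∈ H ∨ b ∈ H ∧ c ∈ H)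

/-- A minimizer of the sum of distances works: were it outside a halfspace containing two of the
points, one step towards that halfspace would shorten two distances and lengthen the third by at
most one. -/
theorem exists_isMedian (hX : X.IsCAT0) (a b c : V) : ∃ y, X.IsMedian a b c y := by
  obtain ⟨y, hy⟩ : ∃ y, ∀ z, X.dist a y + X.dist b y + X.dist c y ≤
      X.dist a z + X.dist b z + X.dist c z := by
    have : Nonempty V := ⟨a⟩
    exact ⟨Function.argmin _, fun z =>
      Function.argmin_le (fun y => X.dist a y + X.dist b y + X.dist c y) z⟩
  have key : ∀ H ∈ X.halfspaces, (a ∈ H ∧ b ∈ H ∨ a ∈ H ∧ c ∈ H ∨ b ∈ H ∧ c ∈ H) → y ∈ H := by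
    intro H hH hmaj
    by_contra hyH
    have hne : H.Nonempty := by
      rcases hmaj with h | h | h
      exacts [⟨_, h.1⟩, ⟨_, h.1⟩, ⟨_, h.1⟩]
    obtain ⟨z, hz, hmin⟩ : ∃ z ∈ H, ∀ z' ∈ H, X.dist z y ≤ X.dist z' y :=
      ⟨Function.argminOn (fun z => X.dist z y) H hne, Function.argminOn_mem _ _ _,
        fun z' hz' => Function.argminOn_le (fun z => X.dist z y) _ hz'⟩
    obtain ⟨y₁, hadj, hd⟩ := exists_adj_dist hX (show z ≠ y from fun h => hyH (h ▸ hz))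
    have hsub := subset_halfspace_of_nearest hX hH hz hyH hmin hadj hd
    have h0 := hy y₁
    have h1 := dist_adj hX a hadj
    have h2 := dist_adj hX b hadj
    have h3 := dist_adj hX c hadj
    rcases hmaj with ⟨h, h'⟩ | ⟨h, h'⟩ | ⟨h, h'⟩ <;>
    · have h4 := mem_halfspace.1 (hsub h)
      have h5 := mem_halfspace.1 (hsub h')
      omega
  refine ⟨y, fun H hH => ⟨fun h => ?_, key H hH⟩⟩
  by_contra hcon
  refine key Hᶜ (compl_mem_halfspaces hX hH) ?_ h
  simp only [Set.mem_compl_iff]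
  tauto

end CubeComplex

/-! ### Automorphisms, monotone orbits and minsets. -/

namespace CubeComplex

open scoped Pointwise

variable {V : Type*} {X : CubeComplex V}

theorem adj_smul (g : X.Aut) {u v : V} : X.graph.Adj (g • u) (g • v) ↔ X.graph.Adj u v := by
  have h := g.2 {u, v}
  rw [Set.image_pair] at h
  exact and_congr (MulAction.injective g).ne_iff h

/-- The graph automorphism induced by an automorphism of the complex. -/
def autIso (g : X.Aut) : X.graph ≃g X.graph where
  toEquiv := MulAction.toPerm g
  map_rel_iff' := adj_smul g

theorem dist_smul (hX : X.IsCAT0) (g : X.Aut) (x y : V) : X.dist (g • x) (g • y) = X.dist x y := by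
  have key : ∀ (g : X.Aut) (x y : V), X.dist (g • x) (g • y) ≤ X.dist x y := by
    intro g x y
    obtain ⟨p, hp⟩ := hX.1.1.exists_walk_length_eq_dist x y
    have := SimpleGraph.dist_le (p.map (autIso g).toHom)
    rw [SimpleGraph.Walk.length_map, hp] at this
    exact this
  refine (key g x y).antisymm ?_
  simpa using key g⁻¹ (g • x) (g • y)

theorem smul_mem_halfspaces (hX : X.IsCAT0) (g : X.Aut) {H : Set V} (hH : H ∈ X.halfspaces) :
    g • H ∈ X.halfspaces := by
  obtain ⟨u, v, h, rfl⟩ := hH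
  refine ⟨g • u, g • v, (adj_smul g).2 h, ?_⟩
  ext w
  rw [Set.mem_smul_set_iff_inv_smul_mem, mem_halfspace, mem_halfspace,
    ← dist_smul hX g (g⁻¹ • w) u, ← dist_smul hX g (g⁻¹ • w) v, smul_inv_smul]

theorem mem_minset_of_dist_pow (hX : X.IsCAT0) (g : X.Aut) {y : V}
    (h : ∀ k : ℕ, X.dist y (g ^ k • y) = k * X.dist y (g • y)) : y ∈ X.minset g := by
  have key : ∀ z, X.dist y (g • y) ≤ X.dist z (g • z) := by
    intro z
    have hz : ∀ k : ℕ, X.dist z (g ^ k • z) ≤ k * X.dist z (g • z) := by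
      intro k
      induction k with
      | zero => simp [dist_self]
      | succ k ih =>
        have h1 := dist_triangle hX z (g ^ k • z) (g ^ (k + 1) • z)
        rw [pow_succ, mul_smul, dist_smul hX] at h1
        rw [pow_succ, mul_smul, add_mul, one_mul]
        omega
    by_contra hlt
    -- The distances from `y` and `z` to their `k`-th translates differ by at most twice `X.dist y
    -- z`, so a smaller displacement at `z` fails for this `k`.
    set k := 2 * X.dist y z + 1 with hk
    have h1 := hz k
    have h2 := h k
    have h3 := dist_triangle hX y z (g ^ k • y)
    have h4 := dist_triangle hX z (g ^ k • z) (g ^ k • y)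
    rw [dist_smul hX, dist_comm z y] at h4
    have h5 : k * (X.dist z (g • z) + 1) ≤ k * X.dist y (g • y) :=
      Nat.mul_le_mul_left _ (by omega)
    rw [mul_add, mul_one] at h5
    omega
  have : Nonempty V := ⟨y⟩
  exact le_antisymm (le_ciInf key) (ciInf_le' (fun x => X.dist x (g • x)) y)

/-- The orbit of `y` under `g` crosses the boundary of `H` at most once. -/
def OrbitMonotone (g : X.Aut) (y : V) (H : Set V) : Prop :=
  Monotone (fun k : ℤ => g ^ k • y ∈ H) ∨ Antitone (fun k : ℤ => g ^ k • y ∈ H)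

theorem mem_minset_of_orbitMonotone (hX : X.IsCAT0) (g : X.Aut) {y : V}
    (h : ∀ H ∈ X.halfspaces, OrbitMonotone g y H) : y ∈ X.minset g := by
  refine mem_minset_of_dist_pow hX g fun k => ?_
  induction k with
  | zero => simp [dist_self]
  | succ k ih =>
    have h1 := between_of_forall_mem hX (x := y) (y := g ^ k • y) (z := g ^ (k + 1) • y) (by
      intro H hH h0 h1
      rcases h H hH with hm | hm
      · exact hm (show (0 : ℤ) ≤ k by simp) (by simpa using h0)
      · refine hm (show (k : ℤ) ≤ (k : ℤ) + 1 by simp) ?_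
        exact_mod_cast h1)
    rw [← h1, ih, pow_succ, mul_smul, dist_smul hX, add_mul, one_mul]

theorem monotone_or_antitone_of_convex {P : ℤ → Prop} (h : ∀ i j k, i ≤ j → j ≤ k → P i → P k → P j)
    (h' : ∀ i j k, i ≤ j → j ≤ k → ¬ P i → ¬ P k → ¬ P j) : Monotone P ∨ Antitone P := by
  by_contra hcon
  simp only [Monotone, Antitone, not_or, not_forall] at hcon
  obtain ⟨⟨a, b, hab, h1⟩, ⟨c, d, hcd, h2⟩⟩ := hcon
  have ha : P a := by_contra fun ha => h1 fun hp => absurd hp ha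
  have hb : ¬ P b := fun hb => h1 fun _ => hb
  have hd : P d := by_contra fun hd => h2 fun hp => absurd hp hd
  have hc : ¬ P c := fun hc => h2 fun _ => hc
  rcases le_total a c with hac | hac
  · exact hc (h a c d hac hcd ha hd)
  · exact h' c a b hac hab hc hb ha

theorem IsLoxodromic.exists_orbitMonotone (hX : X.IsCAT0) {g : X.Aut} (hg : X.IsLoxodromic g) :
    ∃ x, ∀ H ∈ X.halfspaces, OrbitMonotone g x H := by
  obtain ⟨γ, hγ, n, -, hn⟩ := hg
  have hpow : ∀ k : ℤ, g ^ k • γ 0 = γ (k * n) := by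
    have h1 : ∀ i, g • γ i = γ (i + n) := hn
    intro k
    induction k with
    | zero => simp
    | succ k ih => rw [add_comm, zpow_add, zpow_one, mul_smul, ih, h1]; ring_nf
    | pred k ih =>
      rw [sub_eq_neg_add, zpow_add, zpow_neg_one, mul_smul, ih, inv_smul_eq_iff, h1]
      ring_nf
  refine ⟨γ 0, fun H hH => ?_⟩
  have hbet : ∀ i j k : ℤ, i ≤ j → j ≤ k → X.dist (γ (i * n)) (γ (j * n)) +
      X.dist (γ (j * n)) (γ (k * n)) = X.dist (γ (i * n)) (γ (k * n)) := by
    intro i j k hij hjk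
    rw [hγ, hγ, hγ, ← sub_mul, ← sub_mul, ← sub_mul, Int.natAbs_mul, Int.natAbs_mul,
      Int.natAbs_mul, ← add_mul]
    congr 1
    omega
  refine monotone_or_antitone_of_convex ?_ ?_
  · intro i j k hij hjk
    simp only [hpow]
    exact mem_of_between hX (hbet i j k hij hjk) hH
  · intro i j k hij hjk
    simp only [hpow]
    exact mem_of_between hX (hbet i j k hij hjk) (compl_mem_halfspaces hX hH)

theorem OrbitMonotone.smul (hX : X.IsCAT0) {f g : X.Aut} (hfg : Commute f g) {x : V}
    (h : ∀ H ∈ X.halfspaces, OrbitMonotone g x H) :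
    ∀ H ∈ X.halfspaces, OrbitMonotone g (f • x) H := by
  intro H hH
  have := h _ (smul_mem_halfspaces hX f⁻¹ hH)
  simpa only [OrbitMonotone, Set.mem_inv_smul_set_iff, smul_smul, (hfg.zpow_right _).eq] using this

theorem OrbitMonotone.pow {g : X.Aut} {x : V} {H : Set V} (h : OrbitMonotone g x H) (m : ℕ) :
    OrbitMonotone (g ^ m) x H := by
  have hm : Monotone fun k : ℤ => (m : ℤ) * k := fun a b hab =>
    mul_le_mul_of_nonneg_left hab (by positivity)
  have : (fun k : ℤ => (g ^ m) ^ k • x ∈ H) = (fun k : ℤ => g ^ k • x ∈ H) ∘ fun k => m * k := by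
    funext k
    simp only [Function.comp_apply, zpow_mul, zpow_natCast]
  rw [OrbitMonotone, this]
  exact h.imp (fun h => h.comp hm) (fun h => h.comp_monotone hm)

/-- Orbits cross a halfspace in the same direction. -/
theorem monotone_of_not_antitone (hX : X.IsCAT0) (g : X.Aut) {x y : V} {H : Set V}
    (hH : H ∈ X.halfspaces) (hx : OrbitMonotone g x H) (hy : OrbitMonotone g y H)
    (hx' : ¬ Antitone (fun k : ℤ => g ^ k • x ∈ H)) : Monotone (fun k : ℤ => g ^ k • y ∈ H) := by
  rcases hy with hy | hy
  · exact hy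
  replace hx := hx.resolve_right hx'
  by_contra hy'
  simp only [Monotone, Antitone, not_forall] at hx' hy'
  obtain ⟨a, b, hab, h1⟩ := hy'
  obtain ⟨c, d, hcd, h2⟩ := hx'
  have hb : g ^ b • y ∉ H := fun hb => h1 fun _ => hb
  have hd : g ^ d • x ∈ H := by_contra fun hd => h2 fun hp => absurd hp hd
  have hc : g ^ c • x ∉ H := fun hc => h2 fun _ => hc
  -- If the orbits crossed in opposite directions, all these translates would separate `x` from `y`.
  -- Two of them must coincide, so a nontrivial power of `g` preserves `H`, and the nonconstant
  -- monotone sequence of `x` would be periodic.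
  have hmem : ∀ k : ℕ, (g ^ (max b d + k))⁻¹ • H ∈ X.sep x y := by
    intro k
    refine ⟨smul_mem_halfspaces hX _ hH, ?_, ?_⟩
    · rw [Set.mem_inv_smul_set_iff]
      exact hx (show d ≤ max b d + k by omega) hd
    · rw [Set.mem_inv_smul_set_iff]
      exact fun h => hb (hy (show b ≤ max b d + k by omega) h)
  have : Finite (X.sep x y) := (sep_finite_ncard hX x y).1
  obtain ⟨k, l, hkl, heq⟩ := Finite.exists_ne_map_eq_of_infinite
    fun k : ℕ => (⟨_, hmem k⟩ : X.sep x y)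
  have heq' : (g ^ (max b d + (k : ℤ)))⁻¹ • H = (g ^ (max b d + (l : ℤ)))⁻¹ • H :=
    congrArg Subtype.val heq
  clear heq
  wlog hlt : k < l generalizing k l
  · exact this l k hkl.symm heq'.symm (by omega)
  have hper : ∀ i : ℤ, g ^ (i + (l - k : ℤ)) • x ∈ H ↔ g ^ i • x ∈ H := by
    intro i
    have h3 : g ^ (i - k - max b d) • x ∈ (g ^ (max b d + (k : ℤ)))⁻¹ • H ↔
        g ^ (i - k - max b d) • x ∈ (g ^ (max b d + (l : ℤ)))⁻¹ • H := by rw [heq']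
    rw [Set.mem_inv_smul_set_iff, Set.mem_inv_smul_set_iff, smul_smul, smul_smul, ← zpow_add,
      ← zpow_add] at h3
    rw [show i + (l - k : ℤ) = max b d + (l : ℤ) + (i - k - max b d) by ring, ← h3]
    ring_nf
  have hper' : ∀ N : ℕ, g ^ (c + N * (l - k : ℤ)) • x ∉ H := by
    intro N
    induction N with
    | zero => simpa using hc
    | succ N ih =>
      rw [show c + ((N + 1 : ℕ) : ℤ) * (l - k : ℤ) = c + N * (l - k : ℤ) + (l - k : ℤ) by
        push_cast; ring, hper]
      exact ih
  refine hper' (d - c).toNat (hx (?_ : d ≤ _) hd)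
  rw [Int.toNat_of_nonneg (by omega)]
  nlinarith [show (1 : ℤ) ≤ l - k by omega]

theorem IsMedian.orbitMonotone (hX : X.IsCAT0) (g : X.Aut) {a b c y : V} (hy : X.IsMedian a b c y)
    (ha : ∀ H ∈ X.halfspaces, OrbitMonotone g a H) (hb : ∀ H ∈ X.halfspaces, OrbitMonotone g b H)
    (hc : ∀ H ∈ X.halfspaces, OrbitMonotone g c H) :
    ∀ H ∈ X.halfspaces, OrbitMonotone g y H := by
  intro H hH
  have hiff : ∀ k : ℤ, g ^ k • y ∈ H ↔ (g ^ k • a ∈ H ∧ g ^ k • b ∈ H ∨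
      g ^ k • a ∈ H ∧ g ^ k • c ∈ H ∨ g ^ k • b ∈ H ∧ g ^ k • c ∈ H) := by
    intro k
    have := hy _ (smul_mem_halfspaces hX (g ^ k)⁻¹ hH)
    simpa only [Set.mem_inv_smul_set_iff] using this
  by_cases h : Antitone (fun k : ℤ => g ^ k • a ∈ H) ∧ Antitone (fun k : ℤ => g ^ k • b ∈ H) ∧
      Antitone (fun k : ℤ => g ^ k • c ∈ H)
  · obtain ⟨h1, h2, h3⟩ := h
    refine .inr fun i j hij => ?_
    have h1 := h1 hij
    have h2 := h2 hij
    have h3 := h3 hij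
    simp only [le_Prop_eq, hiff] at *
    tauto
  · have h : Monotone (fun k : ℤ => g ^ k • a ∈ H) ∧ Monotone (fun k : ℤ => g ^ k • b ∈ H) ∧
        Monotone (fun k : ℤ => g ^ k • c ∈ H) := by
      by_cases h1 : Antitone (fun k : ℤ => g ^ k • a ∈ H)
      · by_cases h2 : Antitone (fun k : ℤ => g ^ k • b ∈ H)
        · have h3 : ¬ Antitone (fun k : ℤ => g ^ k • c ∈ H) := fun h3 => h ⟨h1, h2, h3⟩
          have key := fun z hz => monotone_of_not_antitone hX g (y := z) hH (hc H hH) hz h3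
          exact ⟨key _ (ha H hH), key _ (hb H hH), key _ (hc H hH)⟩
        · have key := fun z hz => monotone_of_not_antitone hX g (y := z) hH (hb H hH) hz h2
          exact ⟨key _ (ha H hH), key _ (hb H hH), key _ (hc H hH)⟩
      · have key := fun z hz => monotone_of_not_antitone hX g (y := z) hH (ha H hH) hz h1
        exact ⟨key _ (ha H hH), key _ (hb H hH), key _ (hc H hH)⟩
    obtain ⟨h1, h2, h3⟩ := h
    refine .inl fun i j hij => ?_
    have h1 := h1 hij
    have h2 := h2 hij
    have h3 := h3 hij
    simp only [le_Prop_eq, hiff] at *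
    tauto

theorem exists_pow_smul_eq (h : X.Aut) {S : Set (Set V)} (hS : S.Finite) :
    ∃ m : ℕ, 0 < m ∧ ∀ K ∈ S, ∀ K' ∈ S, ∀ j : ℤ, j ≠ 0 → (h ^ m) ^ j • K = K' → h ^ m • K = K := by
  have key : ∀ s : Set V × Set V, ∃ e : ℕ, 0 < e ∧ ∀ m : ℕ, 0 < m → e ∣ m →
      ∀ j : ℤ, j ≠ 0 → (h ^ m) ^ j • s.1 = s.2 → h ^ m • s.1 = s.1 := by
    rintro ⟨K, K'⟩
    by_cases hper : ∃ a : ℕ, 0 < a ∧ h ^ a • K = K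
    · obtain ⟨a, ha, haK⟩ := hper
      refine ⟨a, ha, ?_⟩
      rintro m - ⟨c, rfl⟩ j - -
      have : h ^ a ∈ MulAction.stabilizer X.Aut K := haK
      rw [pow_mul]
      exact pow_mem this c
    · have hinj : ∀ a b : ℤ, h ^ a • K = K' → h ^ b • K = K' → a = b := by
        intro a b ha hb
        by_contra hab
        have h1 : h ^ (a - b) ∈ MulAction.stabilizer X.Aut K := by
          rw [MulAction.mem_stabilizer_iff, sub_eq_neg_add, zpow_add, zpow_neg, mul_smul,
            inv_smul_eq_iff, ha, hb]
        refine hper ⟨(a - b).natAbs, by omega, ?_⟩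
        rcases Int.natAbs_eq (a - b) with h2 | h2
        · rw [h2, zpow_natCast] at h1
          exact h1
        · rw [h2, zpow_neg, zpow_natCast, inv_mem_iff] at h1
          exact h1
      by_cases hex : ∃ a : ℤ, h ^ a • K = K'
      · obtain ⟨a, ha⟩ := hex
        -- Only the exponent `a` carries `K` to `K'`, and every nonzero multiple of `m` exceeds it
        -- in absolute value.
        refine ⟨a.natAbs + 1, by omega, fun m hm hdvd j hj hjK => ?_⟩
        rw [← zpow_natCast, ← zpow_mul] at hjK
        have h1 := congrArg Int.natAbs (hinj _ _ hjK ha)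
        rw [Int.natAbs_mul, Int.natAbs_natCast] at h1
        have h2 := Nat.le_of_dvd hm hdvd
        have h3 := Nat.mul_le_mul_left m (show 1 ≤ j.natAbs by omega)
        omega
      · refine ⟨1, one_pos, fun m _ _ j _ hjK => ?_⟩
        rw [← zpow_natCast, ← zpow_mul] at hjK
        exact absurd ⟨_, hjK⟩ hex
  choose e he hP using key
  refine ⟨∏ s ∈ (hS.prod hS).toFinset, e s, Finset.prod_pos fun s _ => he s, ?_⟩
  intro K hK K' hK' j hj
  refine hP (K, K') _ (Finset.prod_pos fun s _ => he s) (Finset.dvd_prod_of_mem e ?_) j hj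
  simp [hK, hK']

/-- For a suitable power of `h`, the orbits of `x` and `q` agree, up to one position, with respect
to each halfspace that this power does not preserve. -/
theorem exists_pow_orbit_agree (hX : X.IsCAT0) (h : X.Aut) (x q : V) :
    ∃ m : ℕ, 0 < m ∧ ∀ H ∈ X.halfspaces, h ^ m • H = H ∨
      ∃ j₀ : ℤ, ∀ j : ℤ, j ≠ j₀ → ((h ^ m) ^ j • x ∈ H ↔ (h ^ m) ^ j • q ∈ H) := by
  obtain ⟨m, hm, hS⟩ := exists_pow_smul_eq h
    ((sep_finite_ncard hX x q).1.union (sep_finite_ncard hX q x).1)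
  refine ⟨m, hm, fun H hH => or_iff_not_imp_left.2 fun hinv => ?_⟩
  generalize h ^ m = f at hS hinv ⊢
  have hmem : ∀ j : ℤ, ¬ (f ^ j • x ∈ H ↔ f ^ j • q ∈ H) →
      (f ^ j)⁻¹ • H ∈ X.sep x q ∪ X.sep q x := by
    intro j hj
    have hH' := smul_mem_halfspaces hX (f ^ j)⁻¹ hH
    simp only [sep, Set.mem_union, Set.mem_ofPred_eq, Set.mem_inv_smul_set_iff]
    tauto
  by_contra! hcon
  obtain ⟨j, -, hj⟩ := hcon 0
  obtain ⟨l, hl, hl'⟩ := hcon j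
  have hj' := hmem j (by tauto)
  have hl'' := hmem l (by tauto)
  -- Two exceptional indices give two translates of `H` separating `x` and `q`, related by a nonzero
  -- power of `f`. Hence `f` fixes the first, and therefore `H`.
  have := hS _ hj' _ hl'' (j - l) (by omega) (by
    rw [← zpow_neg, ← zpow_neg, smul_smul, ← zpow_add]
    ring_nf)
  refine hinv ?_
  rw [smul_smul, ((Commute.refl f).zpow_right j).inv_right.eq, mul_smul] at this
  exact smul_left_cancel _ this

theorem orbitMonotone_median_of_agree (hX : X.IsCAT0) (f : X.Aut) {x q y : V}
    (hy : X.IsMedian x (f • x) (f ^ 2 • x) y) {H : Set V} (hH : H ∈ X.halfspaces)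
    (hq : OrbitMonotone f q H) (hag : f • H = H ∨
      ∃ j₀ : ℤ, ∀ j : ℤ, j ≠ j₀ → (f ^ j • x ∈ H ↔ f ^ j • q ∈ H)) : OrbitMonotone f y H := by
  rcases hag with hinv | ⟨j₀, hag⟩
  · left
    intro i j _
    have hstab : ∀ k : ℤ, f ^ k • y ∈ H ↔ y ∈ H := by
      intro k
      have : f ^ k • H = H := zpow_mem (show f ∈ MulAction.stabilizer X.Aut H from hinv) k
      conv_lhs => rw [← this]
      exact Set.smul_mem_smul_set_iff
    simp [hstab]
  · have hiff : ∀ k : ℤ, f ^ k • y ∈ H ↔ (f ^ k • x ∈ H ∧ f ^ (k + 1) • x ∈ H ∨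
        f ^ k • x ∈ H ∧ f ^ (k + 1 + 1) • x ∈ H ∨
        f ^ (k + 1) • x ∈ H ∧ f ^ (k + 1 + 1) • x ∈ H) := by
      intro k
      have := hy _ (smul_mem_halfspaces hX (f ^ k)⁻¹ hH)
      simpa only [Set.mem_inv_smul_set_iff, zpow_add, zpow_one, mul_smul, pow_two] using this
    refine hq.imp (fun hq => monotone_int_of_le_succ fun k => ?_)
      (fun hq => antitone_int_of_succ_le fun k => ?_)
    -- The majorities at `k` and `k + 1` involve four consecutive positions, of which at most one is
    -- the exceptional `j₀`.
    all_goals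
      have h0 := hag k
      have h1 := hag (k + 1)
      have h2 := hag (k + 1 + 1)
      have h3 := hag (k + 1 + 1 + 1)
      have m0 := hq (show k ≤ k + 1 by omega)
      have m1 := hq (show k + 1 ≤ k + 1 + 1 by omega)
      have m2 := hq (show k + 1 + 1 ≤ k + 1 + 1 + 1 by omega)
      simp only [le_Prop_eq, hiff] at *
      by_cases e0 : k = j₀
      · have := h1 (by omega); have := h2 (by omega); have := h3 (by omega)
        grind
      by_cases e1 : k + 1 = j₀
      · have := h0 (by omega); have := h2 (by omega); have := h3 (by omega)
        grind
      by_cases e2 : k + 1 + 1 = j₀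
      · have := h0 (by omega); have := h1 (by omega); have := h3 (by omega)
        grind
      · have := h0 e0; have := h1 e1; have := h2 e2
        grind

end CubeComplex

theorem mainTheorem2 {V : Type*} (X : CubeComplex V) (hX : X.IsCAT0)
    (g h : X.Aut) (hg : X.IsLoxodromic g) (hh : X.IsLoxodromic h) (hgh : Commute g h) :
    ∃ m : ℕ, 0 < m ∧ (X.minset g ∩ X.minset (h ^ m)).Nonempty := by
  obtain ⟨x, hx⟩ := hg.exists_orbitMonotone hX
  obtain ⟨q, hq⟩ := hh.exists_orbitMonotone hX
  obtain ⟨m, hm, hag⟩ := CubeComplex.exists_pow_orbit_agree hX h x q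
  obtain ⟨y, hy⟩ := CubeComplex.exists_isMedian hX x (h ^ m • x) ((h ^ m) ^ 2 • x)
  have hcomm : Commute (h ^ m) g := (hgh.pow_right m).symm
  refine ⟨m, hm, y, ?_, ?_⟩
  · exact CubeComplex.mem_minset_of_orbitMonotone hX g (hy.orbitMonotone hX g hx
      (CubeComplex.OrbitMonotone.smul hX hcomm hx)
      (CubeComplex.OrbitMonotone.smul hX (hcomm.pow_left 2) hx))
  · exact CubeComplex.mem_minset_of_orbitMonotone hX _ fun H hH =>
      CubeComplex.orbitMonotone_median_of_agree hX _ hy hH ((hq H hH).pow m) (hag H hH)
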